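/- Let $c>0$, $c_{\min}>0$, $c_{\max}$ and $\kappa$ be real constants. There is a constant $C=C(c,c_{\min},c_{\max},\kappa)>0$ such that the following holds for all integers $n,p,k\ge 0$. Let $\mathcal S\subseteq\{\beta\in\mathbb R^p:\ \mathrm{card}(\beta)\le k\}$ be a closed set that is scale-invariant ($a\beta\in\mathcal S$ for all $a\in\mathbb R$, $\beta\in\mathcal S$) and spans $\mathbb R^p$, where $\mathrm{card}(\beta)$ is the number of nonzero entries of $\beta$. Let $\|\beta\|_{\mathcal S}=\inf\{\gamma>0:\beta\in\gamma\,\mathrm{conv}\{b\in\mathcal S:\|b\|_2=1\}\}$ be the associated norm, and let $\|z\|_{\mathcal S}^\star=\sup\{\langle \beta,z\rangle:\|\beta\|_{\mathcal S}\le1\}$ be its dual norm. For $\beta^\star\in\mathbb R^p\setminus\{0\}$ let $\varphi$ be the Hausdorff distance in $\ell_2$ between the dual unit ball $\{z:\|z\|_{\mathcal S}^\star\le 1\}$ and the subdifferential $\partial\|\beta^\star\|_{\mathcal S}$, and let $\mathcal C(\varphi)=\{v\in\mathbb R^p:\|v\|_{\mathcal S}\le 2\varphi\|v\|_2\}$.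 Let $X\in\mathbb R^{n\times p}$ be a random matrix with independent rows $x_1,\dots,x_n$, all having the same second moment matrix $\mathbb E[x_ix_i^{\sf T}]=\Sigma$, with smallest and largest eigenvalues satisfying $c_{\min}\le\lambda_{\min}(\Sigma)$ and $\lambda_{\max}(\Sigma)\le c_{\max}$, and with subgaussian norms $\|x_i\|_{\psi_2}=\sup_{\|v\|_2=1}\sup_{q\ge1}q^{-1/2}(\mathbb E|\langle x_i,v\rangle|^q)^{1/q}\le\kappa$. Put $\lambda_{\min}=\lambda_{\min}(\Sigma)$ and $\widehat\Sigma=X^{\sf T}X/n$. If $$n\ \ge\ C\,\lambda_{\min}^{-2}\,\varphi^4\,k\log p ,$$ then with probability at least $1-2p^{-ck}$ the matrix $\widehat\Sigma$ satisfies the restricted eigenvalue condition over $\mathcal C(\varphi)$ with constant $\lambda_{\min}/2$, that is, $$\frac{\frac1n\|Xu\|_2^2}{\|u\|_2^2}\ \ge\ \frac{\lambda_{\min}}2\qquad\text{for all } u\in\mathcal C(\varphi)\setminus\{0\}.$$ -/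

import Mathlib

open MeasureTheory ProbabilityTheory
open scoped NNReal ENNReal

noncomputable section

namespace StructureNorm

/-- `ℝ^p` with its Euclidean norm. -/
abbrev Vec (p : ℕ) : Type := EuclideanSpace ℝ (Fin p)

/-- The number of nonzero coordinates of `b`. -/
def card {p : ℕ} (b : Vec p) : ℕ := {i : Fin p | b i ≠ 0}.ncard

/-- The convex hull of the unit vectors of `S`. -/
def atomBall {p : ℕ} (S : Set (Vec p)) : Set (Vec p) :=
  convexHull ℝ {b | b ∈ S ∧ ‖b‖ = 1}

/-- The structure norm of `S`: `inf {γ > 0 : b ∈ γ • atomBall S}`. -/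
def snorm {p : ℕ} (S : Set (Vec p)) (b : Vec p) : ℝ := gauge (atomBall S) b

/-- The dual norm of `f`: `sup {⟨b, z⟩ : f b ≤ 1}`. -/
def dualNorm {p : ℕ} (f : Vec p → ℝ) (z : Vec p) : ℝ :=
  sSup ((fun b => inner ℝ b z) '' {b | f b ≤ 1})

/-- The unit ball of the dual norm. -/
def dualBall {p : ℕ} (f : Vec p → ℝ) : Set (Vec p) := {z | dualNorm f z ≤ 1}

/-- The subdifferential of `f` at `b`. -/
def subdifferential {p : ℕ} (f : Vec p → ℝ) (b : Vec p) : Set (Vec p) :=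
  {g | ∀ y, f b + inner ℝ g (y - b) ≤ f y}

/-- The relative diameter of `b` with respect to `f`: the Hausdorff distance in `ℓ₂` between
the dual unit ball and the subdifferential of `f` at `b`. -/
def relDiam {p : ℕ} (f : Vec p → ℝ) (b : Vec p) : ℝ :=
  Metric.hausdorffDist (dualBall f) (subdifferential f b)

/-- The cone `{v : f v ≤ 2 φ ‖v‖₂}`. -/
def errorCone {p : ℕ} (f : Vec p → ℝ) (φ : ℝ) : Set (Vec p) := {v | f v ≤ 2 * φ * ‖v‖}

/-- The smallest eigenvalue of a (nonempty, symmetric) real matrix. -/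
def minEig {p : ℕ} (A : Matrix (Fin p) (Fin p) ℝ) : ℝ := sInf (spectrum ℝ A)

/-- The largest eigenvalue of a (nonempty, symmetric) real matrix. -/
def maxEig {p : ℕ} (A : Matrix (Fin p) (Fin p) ℝ) : ℝ := sSup (spectrum ℝ A)

/-- The subgaussian norm `sup_{q ≥ 1} q^{-1/2} (E |Z|^q)^{1/q}` of a random variable. -/
def psi2Norm {Ω : Type*} [MeasurableSpace Ω] (μ : Measure Ω) (Z : Ω → ℝ) : ℝ≥0∞ :=
  ⨆ (q : ℝ≥0) (_ : 1 ≤ q), eLpNorm Z (q : ℝ≥0∞) μ / (NNReal.sqrt q : ℝ≥0∞)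

/-- The subgaussian norm of a random vector: the supremum over its unit one-dimensional
marginals. -/
def psi2NormVec {Ω : Type*} [MeasurableSpace Ω] {p : ℕ} (μ : Measure Ω) (x : Ω → Vec p) : ℝ≥0∞ :=
  ⨆ (v : Vec p) (_ : ‖v‖ = 1), psi2Norm μ (fun ω => inner ℝ (x ω) v)

/-- The second moment matrix `E[x xᵀ]`. -/
def secondMoment {Ω : Type*} [MeasurableSpace Ω] {p : ℕ} (μ : Measure Ω) (x : Ω → Vec p) :
    Matrix (Fin p) (Fin p) ℝ :=
  Matrix.of fun j l => ∫ ω, x ω j * x ω l ∂μ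

/-- The `n × p` matrix with the given rows. -/
def designMatrix {n p : ℕ} (rows : Fin n → Vec p) : Matrix (Fin n) (Fin p) ℝ :=
  Matrix.of fun i j => rows i j

/-- The empirical covariance `Xᵀ X / n`. -/
def empCov {n p : ℕ} (X : Matrix (Fin n) (Fin p) ℝ) : Matrix (Fin p) (Fin p) ℝ :=
  (1 / (n : ℝ)) • (X.transpose * X)

/-- The restricted eigenvalue condition for the matrix `G` over `A` with constant `α`:
`uᵀ G u / ‖u‖₂² ≥ α` for all nonzero `u ∈ A`. -/
def SatisfiesRE {p : ℕ} (G : Matrix (Fin p) (Fin p) ℝ) (A : Set (Vec p)) (α : ℝ) : Prop :=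
  ∀ u ∈ A, u ≠ 0 → α ≤ (u.ofLp ⬝ᵥ G.mulVec u.ofLp) / ‖u‖ ^ 2

end StructureNorm

end

namespace StructureNorm

open scoped Pointwise

/-! Write `B` for the bilinear form of the difference between the empirical and the true second
moments. It suffices that `|B u u| ≤ (λ_min / 2) ‖u‖²` on the cone, since the true form is at least
`λ_min ‖u‖²`.

Deterministic half (`abs_bilin_le_of_mem_errorCone`): a nonzero `u` in the cone is at most `4 φ ‖u‖`
times a convex combination of `k`-sparse unit vectors. A bilinear form on a convex hull is
controlled by its values on pairs of atoms, and these by its values on pairs of points of `1/2`-nets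
of `k`-dimensional coordinate subspaces, at the cost of a factor 4. So a bound `M` on net pairs
gives `64 φ² M ‖u‖²`, and `M = λ_min / (128 φ²)` is enough.

Random half (`measureReal_exists_matrixForm_gt_le`): there are at most `p^k * 5^k` net points. For a
fixed pair, `B a b` is an average of independent centred products of subgaussian marginals, which
are subexponential, so Bernstein's inequality applies at level `t = M`. Since `t²` is of order
`λ_min² / φ⁴`, the sample size condition pays for the union bound over pairs. -/

/-! ### Half-nets of coordinate subspaces -/

/-- The unit ball of a finite-dimensional space of dimension `d` has a `1/2`-net with at most
`5 ^ d` points. -/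
theorem exists_half_net (E : Type*) [NormedAddCommGroup E] [NormedSpace ℝ E]
    [FiniteDimensional ℝ E] :
    ∃ N : Finset E, N.card ≤ 5 ^ Module.finrank ℝ E ∧ (∀ a ∈ N, ‖a‖ ≤ 1) ∧
      ∀ x : E, ‖x‖ ≤ 1 → ∃ a ∈ N, ‖x - a‖ ≤ 1 / 2 := by
  classical
  -- Everything is doubled to fit `Besicovitch.card_le_of_separated`. A separated set of maximal
  -- cardinality is a net, since a point far from all of it could be added.
  let P : Finset E → Prop := fun s =>
    (∀ c ∈ s, ‖c‖ ≤ 2) ∧ ∀ c ∈ s, ∀ d ∈ s, c ≠ d → 1 ≤ ‖c - d‖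
  have hP : ∀ s, P s → s.card ≤ 5 ^ Module.finrank ℝ E := fun s hs =>
    Besicovitch.card_le_of_separated s hs.1 hs.2
  let Q : ℕ → Prop := fun m => ∃ s, P s ∧ s.card = m
  have hQ0 : Q 0 := ⟨∅, ⟨by simp, by simp⟩, rfl⟩
  obtain ⟨s, hs, hcard⟩ : Q (Nat.findGreatest Q (5 ^ Module.finrank ℝ E)) :=
    Nat.findGreatest_spec (P := Q) (Nat.zero_le _) hQ0
  refine ⟨s.image fun a => (1 / 2 : ℝ) • a, Finset.card_image_le.trans (hP s hs), ?_, ?_⟩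
  · intro a ha
    obtain ⟨b, hb, rfl⟩ := Finset.mem_image.1 ha
    rw [norm_smul]
    have := hs.1 b hb
    norm_num
    linarith
  · intro x hx
    by_contra! hcon
    have hfar : ∀ a ∈ s, 1 < ‖(2 : ℝ) • x - a‖ := by
      intro a ha
      have h := hcon _ (Finset.mem_image_of_mem _ ha)
      have h2 : (2 : ℝ) • x - a = (2 : ℝ) • (x - (1 / 2 : ℝ) • a) := by
        rw [smul_sub, smul_smul]; norm_num
      rw [h2, norm_smul]
      norm_num at h ⊢
      linarith
    have hx2 : (2 : ℝ) • x ∉ s := fun h => by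
      have := hfar _ h
      simp at this
      linarith
    have hins : P (insert ((2 : ℝ) • x) s) := by
      constructor
      · intro c hc
        rcases Finset.mem_insert.1 hc with rfl | hc
        · rw [norm_smul]; norm_num; exact hx
        · exact hs.1 c hc
      · intro c hc d hd hcd
        rcases Finset.mem_insert.1 hc with rfl | hc <;> rcases Finset.mem_insert.1 hd with rfl | hd
        · exact absurd rfl hcd
        · exact (hfar d hd).le
        · rw [norm_sub_rev]; exact (hfar c hc).le
        · exact hs.2 c hc d hd hcd
    have h1 : (insert ((2 : ℝ) • x) s).card ≤ Nat.findGreatest Q (5 ^ Module.finrank ℝ E) :=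
      Nat.le_findGreatest (hP _ hins) ⟨_, hins, rfl⟩
    rw [Finset.card_insert_of_notMem hx2, hcard] at h1
    omega

/-- A linear functional bounded by `M` on a `1/2`-net of the unit ball is bounded by `2 * M` on
the unit ball. -/
theorem abs_le_two_mul_of_half_net {E : Type*} [NormedAddCommGroup E] [NormedSpace ℝ E]
    [FiniteDimensional ℝ E] {N : Set E} (hN : ∀ x : E, ‖x‖ ≤ 1 → ∃ a ∈ N, ‖x - a‖ ≤ 1 / 2)
    (l : E →ₗ[ℝ] ℝ) {M : ℝ} (hM : ∀ a ∈ N, |l a| ≤ M) {x : E} (hx : ‖x‖ ≤ 1) :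
    |l x| ≤ 2 * M := by
  let L : E →L[ℝ] ℝ := LinearMap.toContinuousLinearMap l
  have hL : ∀ y, L y = l y := fun y => rfl
  have hM0 : 0 ≤ M := by
    obtain ⟨a, ha, -⟩ := hN 0 (by simp)
    exact (abs_nonneg _).trans (hM a ha)
  have key : ∀ y : E, ‖y‖ ≤ 1 → ‖L y‖ ≤ M + ‖L‖ * (1 / 2) := by
    intro y hy
    obtain ⟨a, ha, hya⟩ := hN y hy
    have h1 : L y = L a + L (y - a) := by simp
    rw [h1]
    refine (norm_add_le _ _).trans (add_le_add (hM a ha) ?_)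
    exact (L.le_opNorm _).trans (by gcongr)
  -- The operator norm bounds itself with a factor `1/2`, hence `‖L‖ ≤ 2 * M`.
  have hnorm : ‖L‖ ≤ M + ‖L‖ * (1 / 2) :=
    L.opNorm_le_of_unit_norm (by positivity) fun y hy => key y hy.le
  have := key x hx
  rw [Real.norm_eq_abs, hL] at this
  linarith

/-- The coordinate subspace of the vectors supported on the range of `f`. -/
def coordSubspace {k p : ℕ} (f : Fin k → Fin p) : Submodule ℝ (Vec p) :=
  Submodule.span ℝ (Set.range fun i => EuclideanSpace.single (f i) (1 : ℝ))

theorem finrank_coordSubspace_le {k p : ℕ} (f : Fin k → Fin p) :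
    Module.finrank ℝ (coordSubspace f) ≤ k := by
  have h := finrank_range_le_card (R := ℝ)
    (fun i : Fin k => (EuclideanSpace.single (f i) (1 : ℝ) : Vec p))
  rwa [Fintype.card_fin] at h

/-- `f` enumerates the support and fills the unused slots with a support index `i₀`, which exists
because `b ≠ 0`. Indexing by functions makes the number of subspaces `p ^ k`. -/
theorem exists_mem_coordSubspace {k p : ℕ} {b : Vec p} (hb : b ≠ 0) (hk : card b ≤ k) :
    ∃ f : Fin k → Fin p, b ∈ coordSubspace f := by
  classical
  let T : Finset (Fin p) := Finset.univ.filter fun i => b i ≠ 0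
  have hT : T.card ≤ k := by
    have : card b = T.card := by
      rw [card, ← Set.ncard_coe_finset]
      congr 1
      ext i
      simp [T]
    omega
  obtain ⟨i₀, hi₀⟩ : ∃ i, b i ≠ 0 := by
    by_contra! h
    exact hb (by ext i; simpa using h i)
  let f : Fin k → Fin p := fun j =>
    if h : (j : ℕ) < T.card then (T.equivFin.symm ⟨j, h⟩ : Fin p) else i₀
  have hf : ∀ i, b i ≠ 0 → ∃ j, f j = i := by
    intro i hi
    have hiT : i ∈ T := by simp [T, hi]
    refine ⟨⟨T.equivFin ⟨i, hiT⟩, (T.equivFin ⟨i, hiT⟩).2.trans_le hT⟩, ?_⟩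
    simp [f]
  refine ⟨f, ?_⟩
  have hsum : b = ∑ i, b i • (EuclideanSpace.single i (1 : ℝ) : Vec p) := by
    ext j
    simp [Finset.sum_apply, Pi.single_apply]
  rw [hsum]
  refine Submodule.sum_mem _ fun i _ => ?_
  by_cases hi : b i = 0
  · simp [hi]
  · obtain ⟨j, hj⟩ := hf i hi
    exact Submodule.smul_mem _ _ (Submodule.subset_span ⟨j, by simp [hj]⟩)

/-- A finite set that is a `1/2`-net of the unit ball of the subspace `W`. -/
structure IsHalfNet {p : ℕ} (W : Submodule ℝ (Vec p)) (N : Finset (Vec p)) : Prop where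
  mem : ∀ a ∈ N, a ∈ W
  norm_le : ∀ a ∈ N, ‖a‖ ≤ 1
  exists_near : ∀ x ∈ W, ‖x‖ ≤ 1 → ∃ a ∈ N, ‖x - a‖ ≤ 1 / 2

theorem exists_isHalfNet {k p : ℕ} (W : Submodule ℝ (Vec p)) (hW : Module.finrank ℝ W ≤ k) :
    ∃ N : Finset (Vec p), N.card ≤ 5 ^ k ∧ IsHalfNet W N := by
  classical
  obtain ⟨N, hcard, hN, hnet⟩ := exists_half_net W
  refine ⟨N.image Subtype.val, Finset.card_image_le.trans (hcard.trans
    (Nat.pow_le_pow_right (by norm_num) hW)), ?_, ?_, ?_⟩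
  · intro a ha
    obtain ⟨b, -, rfl⟩ := Finset.mem_image.1 ha
    exact b.2
  · intro a ha
    obtain ⟨b, hb, rfl⟩ := Finset.mem_image.1 ha
    exact hN b hb
  · intro x hx hx1
    obtain ⟨a, ha, hxa⟩ := hnet ⟨x, hx⟩ hx1
    exact ⟨a, Finset.mem_image_of_mem _ ha, hxa⟩

theorem IsHalfNet.abs_le {p : ℕ} {W : Submodule ℝ (Vec p)} {N : Finset (Vec p)}
    (hN : IsHalfNet W N) (l : Vec p →ₗ[ℝ] ℝ) {M : ℝ} (hM : ∀ a ∈ N, |l a| ≤ M) {x : Vec p}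
    (hxW : x ∈ W) (hx : ‖x‖ ≤ 1) : |l x| ≤ 2 * M := by
  refine abs_le_two_mul_of_half_net (E := W) (N := {a : W | (a : Vec p) ∈ N}) ?_
    (l ∘ₗ W.subtype) (fun a ha => hM a ha) (x := ⟨x, hxW⟩) hx
  intro y hy
  obtain ⟨a, ha, hya⟩ := hN.exists_near y y.2 hy
  exact ⟨⟨a, hN.mem a ha⟩, ha, hya⟩

theorem IsHalfNet.abs_bilin_le {p : ℕ} {W W' : Submodule ℝ (Vec p)} {N N' : Finset (Vec p)}
    (hN : IsHalfNet W N) (hN' : IsHalfNet W' N') (B : Vec p →ₗ[ℝ] Vec p →ₗ[ℝ] ℝ) {M : ℝ}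
    (hM : ∀ a ∈ N, ∀ b ∈ N', |B a b| ≤ M) {x y : Vec p} (hxW : x ∈ W) (hx : ‖x‖ ≤ 1)
    (hyW : y ∈ W') (hy : ‖y‖ ≤ 1) : |B x y| ≤ 4 * M := by
  have h := hN.abs_le (B.flip y) (M := 2 * M)
    (fun a ha => by simpa using hN'.abs_le (B a) (hM a ha) hyW hy) hxW hx
  rw [LinearMap.flip_apply] at h
  linarith

/-! ### The structure norm -/

/-- With one argument fixed, the bound defines a convex set in the other; this is used in each
variable in turn. -/
theorem abs_bilin_le_of_mem_convexHull {E : Type*} [AddCommGroup E] [Module ℝ E]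
    (B : E →ₗ[ℝ] E →ₗ[ℝ] ℝ) {A : Set E} {M : ℝ} (hM : ∀ a ∈ A, ∀ b ∈ A, |B a b| ≤ M) {x y : E}
    (hx : x ∈ convexHull ℝ A) (hy : y ∈ convexHull ℝ A) : |B x y| ≤ M := by
  have hconv : ∀ l : E →ₗ[ℝ] ℝ, Convex ℝ {z | |l z| ≤ M} := by
    intro l
    have : {z | |l z| ≤ M} = l ⁻¹' Set.Icc (-M) M := by
      ext z; simp [abs_le]
    rw [this]
    exact (convex_Icc _ _).linear_preimage l
  have h1 : ∀ a ∈ A, |B a y| ≤ M := fun a ha =>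
    convexHull_min (fun b hb => hM a ha b hb) (hconv (B a)) hy
  exact convexHull_min (s := A) (t := {z | |B.flip y z| ≤ M}) (fun a ha => h1 a ha)
    (hconv (B.flip y)) hx

section StructureNormBounds

variable {p : ℕ} {S : Set (Vec p)}

theorem norm_le_of_mem_smul_atomBall {r : ℝ} (hr : 0 ≤ r) {u : Vec p} (hu : u ∈ r • atomBall S) :
    ‖u‖ ≤ r := by
  obtain ⟨a, ha, rfl⟩ := hu
  have h1 : atomBall S ⊆ Metric.closedBall 0 1 :=
    convexHull_min (fun b hb => by simp [hb.2]) (convex_closedBall _ _)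
  have h2 : ‖a‖ ≤ 1 := by simpa using h1 ha
  simp only [norm_smul, Real.norm_eq_abs, abs_of_nonneg hr]
  nlinarith

theorem neg_mem_atomBall (hS : ∀ a : ℝ, ∀ b ∈ S, a • b ∈ S) {u : Vec p} (hu : u ∈ atomBall S) :
    -u ∈ atomBall S := by
  have h : atomBall S ⊆ Neg.neg ⁻¹' atomBall S := by
    refine convexHull_min (fun b hb => subset_convexHull ℝ _ ⟨?_, ?_⟩) ?_
    · simpa using hS (-1) b hb.1
    · simpa using hb.2
    · exact (convex_convexHull ℝ _).linear_preimage (-LinearMap.id : Vec p →ₗ[ℝ] Vec p)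
  exact h hu

/-- The gauge is an `sInf`, equal to 0 on an empty set; spanning rules this out, so lower bounds on
`snorm` are meaningful. -/
theorem exists_mem_smul_atomBall (hS : ∀ a : ℝ, ∀ b ∈ S, a • b ∈ S)
    (hspan : Submodule.span ℝ S = ⊤) {u : Vec p} (hu : u ≠ 0) :
    ∃ r : ℝ, 0 < r ∧ u ∈ r • atomBall S := by
  have hconv : Convex ℝ (atomBall S) := convex_convexHull ℝ _
  have hatom : ∀ b ∈ S, b ≠ 0 → ‖b‖⁻¹ • b ∈ atomBall S := fun b hb hb0 =>
    subset_convexHull ℝ _ ⟨hS _ b hb, by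
      rw [norm_smul, norm_inv, norm_norm, inv_mul_cancel₀ (norm_ne_zero_iff.2 hb0)]⟩
  have hzero : (0 : Vec p) ∈ atomBall S := by
    obtain ⟨b, hb, hb0⟩ : ∃ b ∈ S, b ≠ 0 := by
      by_contra! h
      have h1 : Submodule.span ℝ S = ⊥ := Submodule.span_eq_bot.2 h
      have h2 : u ∈ Submodule.span ℝ S := hspan ▸ Submodule.mem_top
      rw [h1] at h2
      exact hu (by simpa using h2)
    have h1 := hatom b hb hb0
    have := hconv h1 (neg_mem_atomBall hS h1) (a := 1 / 2) (b := 1 / 2) (by norm_num) (by norm_num)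
      (by norm_num)
    simpa using this
  have hmem : u ∈ Submodule.span ℝ S := hspan ▸ Submodule.mem_top
  clear hu
  induction hmem using Submodule.span_induction with
  | zero => exact ⟨1, one_pos, 0, hzero, by simp⟩
  | mem b hb =>
    by_cases hb0 : b = 0
    · exact ⟨1, one_pos, 0, hzero, by simp [hb0]⟩
    · refine ⟨‖b‖, norm_pos_iff.2 hb0, _, hatom b hb hb0, ?_⟩
      simp [smul_smul, mul_inv_cancel₀ (norm_ne_zero_iff.2 hb0)]
  | add x y _ _ hx hy =>
    obtain ⟨r, hr, hxr⟩ := hx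
    obtain ⟨s, hs, hys⟩ := hy
    refine ⟨r + s, by positivity, ?_⟩
    rw [hconv.add_smul hr.le hs.le]
    exact Set.add_mem_add hxr hys
  | smul a x _ hx =>
    obtain ⟨r, hr, y, hy, rfl⟩ := hx
    rcases lt_trichotomy a 0 with ha | rfl | ha
    · refine ⟨-a * r, by nlinarith, -y, neg_mem_atomBall hS hy, ?_⟩
      simp [smul_smul]
    · exact ⟨1, one_pos, 0, hzero, by simp⟩
    · exact ⟨a * r, by positivity, y, hy, by simp [smul_smul]⟩

theorem norm_le_snorm (hS : ∀ a : ℝ, ∀ b ∈ S, a • b ∈ S) (hspan : Submodule.span ℝ S = ⊤)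
    {u : Vec p} (hu : u ≠ 0) : ‖u‖ ≤ snorm S u :=
  le_csInf (exists_mem_smul_atomBall hS hspan hu) fun _ hr =>
    norm_le_of_mem_smul_atomBall hr.1.le hr.2

theorem exists_mem_smul_atomBall_of_snorm_lt (hS : ∀ a : ℝ, ∀ b ∈ S, a • b ∈ S)
    (hspan : Submodule.span ℝ S = ⊤) {u : Vec p} (hu : u ≠ 0) {R : ℝ} (hR : snorm S u < R) :
    ∃ r : ℝ, 0 < r ∧ r < R ∧ u ∈ r • atomBall S := by
  obtain ⟨r, hr, hrR⟩ := exists_lt_of_csInf_lt (exists_mem_smul_atomBall hS hspan hu) hR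
  exact ⟨r, hr.1, hrR, hr.2⟩

/-- A nonzero element of the error cone forces `φ ≥ 1 / 2`. -/
theorem one_le_of_mem_errorCone (hS : ∀ a : ℝ, ∀ b ∈ S, a • b ∈ S)
    (hspan : Submodule.span ℝ S = ⊤) {u : Vec p} (hu : u ≠ 0) {φ : ℝ}
    (hφ : u ∈ errorCone (snorm S) φ) : 1 ≤ 2 * φ := by
  have h1 : ‖u‖ ≤ 2 * φ * ‖u‖ := (norm_le_snorm hS hspan hu).trans hφ
  have h2 : 0 < ‖u‖ := norm_pos_iff.2 hu
  by_contra! h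
  nlinarith

/-- A bilinear form that is at most `M` on nets of all `k`-dimensional coordinate subspaces is
at most `64 φ² M ‖u‖²` on the error cone. -/
theorem abs_bilin_le_of_mem_errorCone {k : ℕ} (hS : ∀ a : ℝ, ∀ b ∈ S, a • b ∈ S)
    (hspan : Submodule.span ℝ S = ⊤) (hk : ∀ b ∈ S, card b ≤ k)
    {N : (Fin k → Fin p) → Finset (Vec p)} (hN : ∀ f, IsHalfNet (coordSubspace f) (N f))
    (B : Vec p →ₗ[ℝ] Vec p →ₗ[ℝ] ℝ) {M : ℝ}
    (hM : ∀ f g, ∀ a ∈ N f, ∀ b ∈ N g, |B a b| ≤ M) {u : Vec p} (hu : u ≠ 0) {φ : ℝ}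
    (hφ : u ∈ errorCone (snorm S) φ) : |B u u| ≤ 64 * φ ^ 2 * M * ‖u‖ ^ 2 := by
  have hφ1 := one_le_of_mem_errorCone hS hspan hu hφ
  have hu0 : 0 < ‖u‖ := norm_pos_iff.2 hu
  -- Doubling `2 φ` makes the inequality strict, so an actual scale `r` below the bound exists
  -- without attainment of the infimum.
  have hlt : snorm S u < 4 * φ * ‖u‖ := by
    have : snorm S u ≤ 2 * φ * ‖u‖ := hφ
    nlinarith
  obtain ⟨r, hr0, hr, a, ha, rfl⟩ := exists_mem_smul_atomBall_of_snorm_lt hS hspan hu hlt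
  have hatom : ∀ x ∈ {b | b ∈ S ∧ ‖b‖ = 1}, ∀ y ∈ {b | b ∈ S ∧ ‖b‖ = 1}, |B x y| ≤ 4 * M := by
    rintro x ⟨hxS, hx⟩ y ⟨hyS, hy⟩
    have hne : ∀ z : Vec p, ‖z‖ = 1 → z ≠ 0 := fun z hz h => by simp [h] at hz
    obtain ⟨f, hf⟩ := exists_mem_coordSubspace (hne x hx) (hk x hxS)
    obtain ⟨g, hg⟩ := exists_mem_coordSubspace (hne y hy) (hk y hyS)
    exact (hN f).abs_bilin_le (hN g) B (hM f g) hf hx.le hg hy.le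
  have hBa := abs_bilin_le_of_mem_convexHull B hatom ha ha
  have hM0 : 0 ≤ 4 * M := (abs_nonneg _).trans hBa
  simp only at hr ⊢
  have hB : |B (r • a) (r • a)| = r ^ 2 * |B a a| := by
    simp only [map_smul, LinearMap.smul_apply, smul_eq_mul, abs_mul, abs_of_pos hr0]
    ring
  rw [hB]
  calc r ^ 2 * |B a a| ≤ (4 * φ * ‖r • a‖) ^ 2 * (4 * M) := by gcongr
    _ = _ := by ring

end StructureNormBounds

/-! ### Sums of independent subexponential variables -/

section Bernstein

variable {Ω : Type*} [MeasurableSpace Ω] {μ : Measure Ω} [IsProbabilityMeasure μ]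

theorem hasSum_pow_div_factorial_exp (x : ℝ) :
    HasSum (fun m : ℕ => x ^ m / (m.factorial : ℝ)) (Real.exp x) := by
  have h := NormedSpace.exp_series_hasSum_exp' (𝕂 := ℝ) x
  rw [← Real.exp_eq_exp_ℝ] at h
  simpa only [smul_eq_mul, div_eq_inv_mul] using h

/-- Bernstein's moment condition bounds the moment generating function near the origin. -/
theorem mgf_le_of_moment_le {V : Ω → ℝ} {G s : ℝ} (hV : Measurable V) (hG : 0 ≤ G)
    (hint : ∀ m : ℕ, Integrable (fun ω => |V ω| ^ m) μ)
    (hmom : ∀ m : ℕ, ∫ ω, |V ω| ^ m ∂μ ≤ m.factorial * G ^ m)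
    (hmean : ∫ ω, V ω ∂μ = 0) (hs : |s| * G ≤ 1 / 2) :
    Integrable (fun ω => Real.exp (s * V ω)) μ ∧
      mgf V μ s ≤ Real.exp (2 * s ^ 2 * G ^ 2) := by
  set r : ℝ := |s| * G with hr
  have hr0 : 0 ≤ r := by positivity
  let F : ℕ → Ω → ℝ := fun m ω => (s * V ω) ^ m / (m.factorial : ℝ)
  have hFmeas : ∀ m, Measurable (F m) := fun m => ((hV.const_mul s).pow_const m).div_const _
  have hFnorm : ∀ m ω, ‖F m ω‖ = |s| ^ m / m.factorial * |V ω| ^ m := by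
    intro m ω
    simp only [F, Real.norm_eq_abs, abs_div, abs_pow, abs_mul, mul_pow, Nat.abs_cast]
    ring
  have hFint : ∀ m, Integrable (F m) μ := by
    intro m
    refine ((hint m).const_mul (|s| ^ m / m.factorial)).mono' (hFmeas m).aestronglyMeasurable ?_
    exact Filter.Eventually.of_forall fun ω => (hFnorm m ω).le
  -- The `m!` in the moment bound cancels the exponential series, leaving a geometric series of
  -- ratio `r ≤ 1/2`.
  have hFle : ∀ m, ∫ ω, ‖F m ω‖ ∂μ ≤ r ^ m := by
    intro m
    simp_rw [hFnorm]
    rw [integral_const_mul]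
    have hf : (0 : ℝ) < m.factorial := by positivity
    calc |s| ^ m / m.factorial * ∫ ω, |V ω| ^ m ∂μ
        ≤ |s| ^ m / m.factorial * (m.factorial * G ^ m) := by
          gcongr; exact hmom m
      _ = r ^ m := by rw [hr, mul_pow]; field_simp
  have hgeo : HasSum (fun m : ℕ => r ^ m) (1 - r)⁻¹ :=
    hasSum_geometric_of_lt_one hr0 (by linarith)
  have hFsum : Summable fun m => ∫ ω, ‖F m ω‖ ∂μ :=
    hgeo.summable.of_nonneg_of_le (fun m => integral_nonneg fun ω => norm_nonneg _) hFle
  have htsum : ∀ ω, ∑' m, F m ω = Real.exp (s * V ω) := fun ω =>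
    (hasSum_pow_div_factorial_exp _).tsum_eq
  have hmain := hasSum_integral_of_summable_integral_norm hFint hFsum
  simp_rw [htsum] at hmain
  constructor
  · refine ⟨(hV.const_mul s).exp.aestronglyMeasurable, ?_⟩
    have hbound : ∀ ω, ‖Real.exp (s * V ω)‖ₑ ≤ ∑' m, ‖F m ω‖ₑ := by
      intro ω
      rw [← htsum ω]
      exact enorm_tsum_le_tsum_enorm
    refine (lintegral_mono hbound).trans_lt ?_
    rw [lintegral_tsum fun m => (hFmeas m).enorm.aemeasurable]
    have h1 : ∀ m, ∫⁻ ω, ‖F m ω‖ₑ ∂μ = ENNReal.ofReal (∫ ω, ‖F m ω‖ ∂μ) := fun m =>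
      (ofReal_integral_norm_eq_lintegral_enorm (hFint m)).symm
    simp_rw [h1]
    rw [← ENNReal.ofReal_tsum_of_nonneg (fun m => integral_nonneg fun ω => norm_nonneg _) hFsum]
    exact ENNReal.ofReal_lt_top
  · have h0 : ∫ ω, F 0 ω ∂μ = 1 := by simp [F]
    have h1 : ∫ ω, F 1 ω ∂μ = 0 := by simp [F, integral_const_mul, hmean]
    -- The terms of order 0 and 1 are 1 and 0; the rest is at most `r² / (1 - r) ≤ 2 r²`.
    have hsplit := (hasSum_nat_add_iff' (f := fun m => ∫ ω, F m ω ∂μ) 2).2 hmain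
    have hgeo2 : HasSum (fun m : ℕ => r ^ (m + 2)) (r ^ 2 * (1 - r)⁻¹) := by
      have h := hgeo.mul_left (r ^ 2)
      simpa only [← pow_add, add_comm 2] using h
    have hle := hasSum_le (fun m => (le_abs_self _).trans
      ((norm_integral_le_integral_norm (F (m + 2))).trans (hFle (m + 2)))) hsplit hgeo2
    simp only [Finset.sum_range_succ, Finset.sum_range_zero, h0, h1] at hle
    have h2 : r ^ 2 * (1 - r)⁻¹ ≤ 2 * r ^ 2 := by
      have : (1 - r)⁻¹ ≤ 2 := by
        rw [inv_le_comm₀ (by linarith) (by norm_num)]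
        linarith
      nlinarith [sq_nonneg r]
    have h3 : r ^ 2 = s ^ 2 * G ^ 2 := by rw [hr, mul_pow, sq_abs]
    have h4 := Real.add_one_le_exp (2 * s ^ 2 * G ^ 2)
    rw [mgf]
    nlinarith

/-- One-sided Bernstein inequality. -/
theorem measureReal_sum_ge_le {n : ℕ} {V : Fin n → Ω → ℝ} {G t : ℝ} (hV : ∀ i, Measurable (V i))
    (hind : iIndepFun V μ) (hG : 0 < G)
    (hint : ∀ i, ∀ m : ℕ, Integrable (fun ω => |V i ω| ^ m) μ)
    (hmom : ∀ i, ∀ m : ℕ, ∫ ω, |V i ω| ^ m ∂μ ≤ m.factorial * G ^ m)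
    (hmean : ∀ i, ∫ ω, V i ω ∂μ = 0) (ht : 0 ≤ t) (htG : t ≤ 2 * G) :
    μ.real {ω | n * t ≤ ∑ i, V i ω} ≤ Real.exp (-(n * t ^ 2 / (8 * G ^ 2))) := by
  -- This `s` minimises `-s t + 2 s² G²`; the condition `|s| * G ≤ 1 / 2` is then exactly `t ≤ 2 *
  -- G`.
  set s : ℝ := t / (4 * G ^ 2) with hs
  have hs0 : 0 ≤ s := by positivity
  have hsG : |s| * G ≤ 1 / 2 := by
    rw [abs_of_nonneg hs0, hs]
    have : t / (4 * G ^ 2) * G = t / (4 * G) := by field_simp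
    rw [this, div_le_iff₀ (by positivity)]
    linarith
  have hmgf := fun i => mgf_le_of_moment_le (hV i) hG.le (hint i) (hmom i) (hmean i) hsG
  have h := measure_ge_le_exp_mul_mgf (μ := μ) (X := ∑ i, V i) (n * t) hs0
    (hind.integrable_exp_mul_sum hV fun i _ => (hmgf i).1)
  rw [hind.mgf_sum hV] at h
  have hprod : ∏ i, mgf (V i) μ s ≤ Real.exp (n * (2 * s ^ 2 * G ^ 2)) := by
    calc ∏ i, mgf (V i) μ s ≤ ∏ _i : Fin n, Real.exp (2 * s ^ 2 * G ^ 2) :=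
          Finset.prod_le_prod (fun i _ => mgf_nonneg) fun i _ => (hmgf i).2
      _ = _ := by simp [← Real.exp_nat_mul]
  simp only [Finset.sum_apply] at h
  calc _ ≤ _ := h
    _ ≤ Real.exp (-s * (n * t)) * Real.exp (n * (2 * s ^ 2 * G ^ 2)) := by gcongr
    _ = _ := by
      rw [← Real.exp_add, hs]
      congr 1
      field_simp
      ring

/-- Two-sided Bernstein inequality. -/
theorem measureReal_abs_sum_ge_le {n : ℕ} {V : Fin n → Ω → ℝ} {G t : ℝ}
    (hV : ∀ i, Measurable (V i)) (hind : iIndepFun V μ) (hG : 0 < G)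
    (hint : ∀ i, ∀ m : ℕ, Integrable (fun ω => |V i ω| ^ m) μ)
    (hmom : ∀ i, ∀ m : ℕ, ∫ ω, |V i ω| ^ m ∂μ ≤ m.factorial * G ^ m)
    (hmean : ∀ i, ∫ ω, V i ω ∂μ = 0) (ht : 0 ≤ t) (htG : t ≤ 2 * G) :
    μ.real {ω | n * t ≤ |∑ i, V i ω|} ≤ 2 * Real.exp (-(n * t ^ 2 / (8 * G ^ 2))) := by
  have h1 := measureReal_sum_ge_le hV hind hG hint hmom hmean ht htG
  have h2 := measureReal_sum_ge_le (V := fun i ω => -V i ω) (fun i => (hV i).neg)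
    (hind.comp (fun _ => Neg.neg) fun _ => measurable_neg) hG
    (by simpa only [abs_neg] using hint) (by simpa only [abs_neg] using hmom)
    (fun i => by rw [integral_neg, hmean i, neg_zero]) ht htG
  have hsub : {ω | n * t ≤ |∑ i, V i ω|} ⊆
      {ω | n * t ≤ ∑ i, V i ω} ∪ {ω | n * t ≤ ∑ i, -V i ω} := by
    intro ω hω
    have hω' : n * t ≤ |∑ i, V i ω| := hω
    simp only [Finset.sum_neg_distrib]
    rcases le_abs.1 hω' with h | h
    · exact Or.inl h
    · exact Or.inr h
  have h3 := (measureReal_mono (μ := μ) hsub).trans (measureReal_union_le _ _)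
  linarith

end Bernstein

/-! ### Moments of products of marginals of a subgaussian vector -/

section Moments

variable {Ω : Type*} [MeasurableSpace Ω] {μ : Measure Ω} {p : ℕ} {x : Ω → Vec p} {κ : ℝ≥0}

/-- The exponent `q = 2 m` in the subgaussian norm gives an `L^q` norm of at most `κ √(2 m)`. -/
theorem lintegral_inner_pow_le_of_norm_eq_one (hκ : psi2NormVec μ x ≤ κ) {v : Vec p}
    (hv : ‖v‖ = 1) {m : ℕ} (hm : 1 ≤ m) :
    ∫⁻ ω, ENNReal.ofReal (inner ℝ (x ω) v ^ (2 * m)) ∂μ ≤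
      ENNReal.ofReal ((2 * m * (κ : ℝ) ^ 2) ^ m) := by
  set q : ℝ≥0 := ((2 * m : ℕ) : ℝ≥0) with hq
  have hq1 : 1 ≤ q := by rw [hq]; exact_mod_cast (by omega : 1 ≤ 2 * m)
  have hq0 : q ≠ 0 := (zero_lt_one.trans_le hq1).ne'
  have h1 : eLpNorm (fun ω => inner ℝ (x ω) v) (q : ℝ≥0∞) μ / (NNReal.sqrt q : ℝ≥0∞) ≤ κ :=
    (le_iSup₂ (f := fun (q : ℝ≥0) (_ : 1 ≤ q) =>
      eLpNorm (fun ω => inner ℝ (x ω) v) (q : ℝ≥0∞) μ / (NNReal.sqrt q : ℝ≥0∞)) q hq1).trans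
      ((le_iSup₂ (f := fun (v : Vec p) (_ : ‖v‖ = 1) =>
        psi2Norm μ (fun ω => inner ℝ (x ω) v)) v hv).trans hκ)
  have h2 : eLpNorm (fun ω => inner ℝ (x ω) v) (q : ℝ≥0∞) μ ≤ κ * NNReal.sqrt q :=
    (ENNReal.div_le_iff (by simpa using hq0) ENNReal.coe_ne_top).1 h1
  have h3 : ∫⁻ ω, ENNReal.ofReal (inner ℝ (x ω) v ^ (2 * m)) ∂μ =
      eLpNorm (fun ω => inner ℝ (x ω) v) (q : ℝ≥0∞) μ ^ (2 * m) := by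
    have h := eLpNorm_nnreal_pow_eq_lintegral (f := fun ω => inner ℝ (x ω) v) (μ := μ) hq0
    have hqr : (q : ℝ) = ((2 * m : ℕ) : ℝ) := by simp [hq]
    rw [hqr] at h
    simp only [ENNReal.rpow_natCast] at h
    rw [h]
    refine lintegral_congr fun ω => ?_
    rw [Real.enorm_eq_ofReal_abs, ← ENNReal.ofReal_pow (abs_nonneg _), pow_mul, pow_mul, sq_abs]
  rw [h3]
  calc _ ≤ ((κ : ℝ≥0∞) * NNReal.sqrt q) ^ (2 * m) := by gcongr
    _ = (((2 * m * κ ^ 2) ^ m : ℝ≥0) : ℝ≥0∞) := by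
      rw [← ENNReal.coe_mul, ← ENNReal.coe_pow, pow_mul, mul_pow, NNReal.sq_sqrt, hq]
      push_cast
      ring
    _ = _ := by
      rw [← ENNReal.ofReal_coe_nnreal]
      push_cast
      rfl

theorem inner_pow_moment (hx : Measurable x) (hκ : psi2NormVec μ x ≤ κ) {v : Vec p}
    (hv : ‖v‖ ≤ 1) {m : ℕ} (hm : 1 ≤ m) :
    Integrable (fun ω => inner ℝ (x ω) v ^ (2 * m)) μ ∧
      ∫ ω, inner ℝ (x ω) v ^ (2 * m) ∂μ ≤ (2 * m * (κ : ℝ) ^ 2) ^ m := by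
  have hnn : ∀ ω, 0 ≤ inner ℝ (x ω) v ^ (2 * m) := fun ω => (even_two_mul m).pow_nonneg _
  have hK : (0 : ℝ) ≤ (2 * m * (κ : ℝ) ^ 2) ^ m := by positivity
  have hmeas : Measurable fun ω => inner ℝ (x ω) v ^ (2 * m) :=
    (hx.inner_const).pow_const _
  have hle : ∫⁻ ω, ENNReal.ofReal (inner ℝ (x ω) v ^ (2 * m)) ∂μ ≤
      ENNReal.ofReal ((2 * m * (κ : ℝ) ^ 2) ^ m) := by
    by_cases hv0 : v = 0
    · simp [hv0, show m ≠ 0 by omega]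
    · have hn : ‖v‖ ≠ 0 := norm_ne_zero_iff.2 hv0
      refine (lintegral_mono fun ω => ENNReal.ofReal_le_ofReal ?_).trans
        (lintegral_inner_pow_le_of_norm_eq_one hκ (v := ‖v‖⁻¹ • v)
          (by rw [norm_smul, norm_inv, norm_norm, inv_mul_cancel₀ hn]) hm)
      have h1 : inner ℝ (x ω) v = ‖v‖ * inner ℝ (x ω) (‖v‖⁻¹ • v) := by
        rw [inner_smul_right, mul_inv_cancel_left₀ hn]
      rw [h1, mul_pow]
      refine mul_le_of_le_one_left ((even_two_mul m).pow_nonneg _) ?_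
      exact pow_le_one₀ (norm_nonneg _) hv
  refine ⟨⟨hmeas.aestronglyMeasurable, ?_⟩, ?_⟩
  · rw [hasFiniteIntegral_iff_ofReal (Filter.Eventually.of_forall hnn)]
    exact hle.trans_lt ENNReal.ofReal_lt_top
  · rw [integral_eq_lintegral_of_nonneg_ae (Filter.Eventually.of_forall hnn)
      hmeas.aestronglyMeasurable]
    exact ENNReal.toReal_le_of_le_ofReal hK hle

theorem inner_mul_inner_moment (hx : Measurable x) (hκ : psi2NormVec μ x ≤ κ) {a b : Vec p}
    (ha : ‖a‖ ≤ 1) (hb : ‖b‖ ≤ 1) {m : ℕ} (hm : 1 ≤ m) :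
    Integrable (fun ω => |inner ℝ (x ω) a * inner ℝ (x ω) b| ^ m) μ ∧
      ∫ ω, |inner ℝ (x ω) a * inner ℝ (x ω) b| ^ m ∂μ ≤ (2 * m * (κ : ℝ) ^ 2) ^ m := by
  obtain ⟨hai, hal⟩ := inner_pow_moment hx hκ ha hm
  obtain ⟨hbi, hbl⟩ := inner_pow_moment hx hκ hb hm
  have hle : ∀ ω, |inner ℝ (x ω) a * inner ℝ (x ω) b| ^ m ≤
      (1 / 2 : ℝ) * (inner ℝ (x ω) a ^ (2 * m) + inner ℝ (x ω) b ^ (2 * m)) := by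
    intro ω
    rw [← abs_pow, mul_pow, mul_comm 2 m, pow_mul, pow_mul, abs_le]
    constructor <;> nlinarith [sq_nonneg (inner ℝ (x ω) a ^ m - inner ℝ (x ω) b ^ m),
      sq_nonneg (inner ℝ (x ω) a ^ m + inner ℝ (x ω) b ^ m)]
  have hsum : Integrable (fun ω => (1 / 2 : ℝ) *
      (inner ℝ (x ω) a ^ (2 * m) + inner ℝ (x ω) b ^ (2 * m))) μ := (hai.add hbi).const_mul _
  have hint : Integrable (fun ω => |inner ℝ (x ω) a * inner ℝ (x ω) b| ^ m) μ := by
    refine hsum.mono' ?_ (Filter.Eventually.of_forall fun ω => ?_)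
    · exact (((hx.inner_const.mul hx.inner_const).abs).pow_const m).aestronglyMeasurable
    · rw [Real.norm_of_nonneg (by positivity)]
      exact hle ω
  refine ⟨hint, (integral_mono hint hsum hle).trans ?_⟩
  rw [integral_const_mul, integral_add hai hbi]
  linarith

/-- One term of the series of `e ^ m`. It turns `m ^ m` growth into the factorial form of
Bernstein's condition. -/
theorem pow_self_le_factorial_mul_exp (m : ℕ) :
    (m : ℝ) ^ m ≤ m.factorial * Real.exp 1 ^ m := by
  have h := Real.pow_div_factorial_le_exp (m : ℝ) (Nat.cast_nonneg m) m
  rw [div_le_iff₀ (by positivity)] at h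
  rw [← Real.exp_nat_mul, mul_one, mul_comm]
  exact h

/-- Centring costs a factor `2 ^ m` by convexity of the power, as the mean is at most `2 κ² ≤ 2 m
κ²`. The `+ 1` keeps the scale positive when `κ = 0`. -/
theorem centered_moment [IsProbabilityMeasure μ] (hx : Measurable x) (hκ : psi2NormVec μ x ≤ κ)
    {a b : Vec p} (ha : ‖a‖ ≤ 1) (hb : ‖b‖ ≤ 1) (m : ℕ) :
    Integrable (fun ω => |inner ℝ (x ω) a * inner ℝ (x ω) b -
        ∫ ω', inner ℝ (x ω') a * inner ℝ (x ω') b ∂μ| ^ m) μ ∧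
      ∫ ω, |inner ℝ (x ω) a * inner ℝ (x ω) b -
        ∫ ω', inner ℝ (x ω') a * inner ℝ (x ω') b ∂μ| ^ m ∂μ ≤
          m.factorial * (4 * Real.exp 1 * ((κ : ℝ) ^ 2 + 1)) ^ m := by
  rcases Nat.eq_zero_or_pos m with rfl | hm
  · simp
  set W : Ω → ℝ := fun ω => inner ℝ (x ω) a * inner ℝ (x ω) b with hW
  set e : ℝ := ∫ ω', W ω' ∂μ with he
  have hWm : Measurable W := hx.inner_const.mul hx.inner_const
  obtain ⟨hi, hl⟩ := inner_mul_inner_moment hx hκ ha hb (show 1 ≤ m from hm)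
  obtain ⟨-, hl1⟩ := inner_mul_inner_moment hx hκ ha hb le_rfl
  have hκ2 : (0 : ℝ) ≤ (κ : ℝ) ^ 2 := by positivity
  have hm1 : (1 : ℝ) ≤ m := by exact_mod_cast hm
  have he1 : |e| ≤ 2 * m * (κ : ℝ) ^ 2 := by
    have h1 : |e| ≤ ∫ ω, |W ω| ∂μ := abs_integral_le_integral_abs
    have h2 : ∫ ω, |W ω| ∂μ ≤ 2 * (κ : ℝ) ^ 2 := by simpa [hW] using hl1
    nlinarith
  have hle : ∀ ω, |W ω - e| ^ m ≤ 2 ^ (m - 1) * (|W ω| ^ m + |e| ^ m) := fun ω =>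
    (pow_le_pow_left₀ (abs_nonneg _) (abs_sub _ _) m).trans
      (add_pow_le (abs_nonneg _) (abs_nonneg _) m)
  have hsum : Integrable (fun ω => (2 : ℝ) ^ (m - 1) * (|W ω| ^ m + |e| ^ m)) μ :=
    (hi.add (integrable_const _)).const_mul _
  have hint : Integrable (fun ω => |W ω - e| ^ m) μ := by
    refine hsum.mono' (((hWm.sub_const e).abs).pow_const m).aestronglyMeasurable
      (Filter.Eventually.of_forall fun ω => ?_)
    rw [Real.norm_of_nonneg (by positivity)]
    exact hle ω
  refine ⟨hint, (integral_mono hint hsum hle).trans ?_⟩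
  rw [integral_const_mul, integral_add hi (integrable_const _)]
  simp only [integral_const, probReal_univ, one_smul]
  have h3 : |e| ^ m ≤ (2 * m * (κ : ℝ) ^ 2) ^ m := pow_le_pow_left₀ (abs_nonneg _) he1 m
  have h4 : (2 : ℝ) ^ m = 2 ^ (m - 1) * 2 := by
    rw [← pow_succ, Nat.sub_add_cancel hm]
  calc (2 : ℝ) ^ (m - 1) * (∫ ω, |W ω| ^ m ∂μ + |e| ^ m)
      ≤ 2 ^ (m - 1) * ((2 * m * (κ : ℝ) ^ 2) ^ m + (2 * m * (κ : ℝ) ^ 2) ^ m) := by gcongr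
    _ = 2 ^ m * (2 * m * (κ : ℝ) ^ 2) ^ m := by rw [h4]; ring
    _ = (m : ℝ) ^ m * (4 * (κ : ℝ) ^ 2) ^ m := by
      rw [← mul_pow, ← mul_pow]; congr 1; ring
    _ ≤ (m.factorial * Real.exp 1 ^ m) * (4 * ((κ : ℝ) ^ 2 + 1)) ^ m := by
      gcongr
      · exact pow_self_le_factorial_mul_exp m
      · linarith
    _ = _ := by rw [mul_assoc, ← mul_pow]; congr 2; ring

end Moments

/-! ### Quadratic forms -/

section Forms

variable {p : ℕ}

/-- The bilinear form of a matrix. -/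
def matrixForm (A : Matrix (Fin p) (Fin p) ℝ) : Vec p →ₗ[ℝ] Vec p →ₗ[ℝ] ℝ :=
  LinearMap.mk₂ ℝ (fun a b => a.ofLp ⬝ᵥ A.mulVec b.ofLp)
    (fun a a' b => by simp [add_dotProduct])
    (fun r a b => by simp [smul_dotProduct])
    (fun a b b' => by simp [Matrix.mulVec_add, dotProduct_add])
    (fun r a b => by simp [Matrix.mulVec_smul, dotProduct_smul])

theorem matrixForm_apply (A : Matrix (Fin p) (Fin p) ℝ) (a b : Vec p) :
    matrixForm A a b = a.ofLp ⬝ᵥ A.mulVec b.ofLp := rfl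

theorem inner_eq_sum (x a : Vec p) : inner ℝ x a = ∑ j, x j * a j := by
  simp [PiLp.inner_apply, mul_comm]

/-- Subtracting `minEig A` times the identity shifts the spectrum to be nonnegative, so the
difference is positive semidefinite. -/
theorem minEig_mul_le_matrixForm {A : Matrix (Fin p) (Fin p) ℝ} (hA : A.IsSymm) (u : Vec p) :
    minEig A * ‖u‖ ^ 2 ≤ matrixForm A u u := by
  have hpsd : (A - algebraMap ℝ (Matrix (Fin p) (Fin p) ℝ) (minEig A)).PosSemidef := by
    rw [Matrix.posSemidef_iff_isHermitian_and_spectrum_nonneg]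
    constructor
    · rw [Matrix.IsHermitian, Matrix.conjTranspose_eq_transpose_of_trivial, Matrix.transpose_sub,
        hA.eq, Matrix.algebraMap_eq_diagonal, Matrix.diagonal_transpose]
    · rw [← spectrum.sub_singleton_eq]
      rintro _ ⟨y, hy, _, rfl, rfl⟩
      exact sub_nonneg.2 (csInf_le Matrix.finite_real_spectrum.bddBelow hy)
  have h := hpsd.dotProduct_mulVec_nonneg u.ofLp
  have hnorm : ‖u‖ ^ 2 = u.ofLp ⬝ᵥ u.ofLp := by
    rw [← real_inner_self_eq_norm_sq, inner_eq_sum]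
    rfl
  rw [Algebra.algebraMap_eq_smul_one, Matrix.sub_mulVec, dotProduct_sub, Matrix.smul_mulVec,
    Matrix.one_mulVec, dotProduct_smul, star_trivial, ← hnorm, smul_eq_mul] at h
  rw [matrixForm_apply]
  linarith

theorem matrixForm_empCov {n : ℕ} (rows : Fin n → Vec p) (a b : Vec p) :
    matrixForm (empCov (designMatrix rows)) a b =
      (1 / (n : ℝ)) * ∑ i, inner ℝ (rows i) a * inner ℝ (rows i) b := by
  have h : ∀ c : Vec p, (designMatrix rows).mulVec c.ofLp = fun i => inner ℝ (rows i) c := by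
    intro c
    ext i
    rw [inner_eq_sum]
    rfl
  rw [matrixForm_apply, empCov, Matrix.smul_mulVec, dotProduct_smul, smul_eq_mul,
    ← Matrix.mulVec_mulVec, Matrix.dotProduct_mulVec, Matrix.vecMul_transpose, h, h]
  rfl

end Forms

/-! ### Population second moments -/

section SecondMoment

variable {Ω : Type*} [MeasurableSpace Ω] {μ : Measure Ω} {p : ℕ} {x : Ω → Vec p} {κ : ℝ≥0}

theorem isSymm_secondMoment : (secondMoment μ x).IsSymm := by
  ext j l
  simp [secondMoment, mul_comm]

theorem integrable_inner_mul_inner (hx : Measurable x) (hκ : psi2NormVec μ x ≤ κ) {a b : Vec p}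
    (ha : ‖a‖ ≤ 1) (hb : ‖b‖ ≤ 1) :
    Integrable (fun ω => inner ℝ (x ω) a * inner ℝ (x ω) b) μ := by
  have h := (inner_mul_inner_moment hx hκ ha hb le_rfl).1
  simp only [pow_one] at h
  exact (integrable_norm_iff (hx.inner_const.mul hx.inner_const).aestronglyMeasurable).1 h

theorem integral_inner_mul_inner (hx : Measurable x) (hκ : psi2NormVec μ x ≤ κ) (a b : Vec p) :
    ∫ ω, inner ℝ (x ω) a * inner ℝ (x ω) b ∂μ = matrixForm (secondMoment μ x) a b := by
  have hint : ∀ j l, Integrable (fun ω => x ω j * x ω l) μ := by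
    intro j l
    have h := integrable_inner_mul_inner hx hκ (a := EuclideanSpace.single j (1 : ℝ))
      (b := EuclideanSpace.single l (1 : ℝ)) (by simp) (by simp)
    simpa [EuclideanSpace.inner_single_right] using h
  have hexp : ∀ ω, inner ℝ (x ω) a * inner ℝ (x ω) b =
      ∑ j, ∑ l, a j * b l * (x ω j * x ω l) := by
    intro ω
    rw [inner_eq_sum, inner_eq_sum, Finset.sum_mul_sum]
    exact Finset.sum_congr rfl fun j _ => Finset.sum_congr rfl fun l _ => by ring
  simp_rw [hexp]
  rw [integral_finsetSum _ fun j _ => integrable_finsetSum _ fun l _ => (hint j l).const_mul _]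
  rw [matrixForm_apply]
  simp only [dotProduct, Matrix.mulVec, Finset.mul_sum]
  refine Finset.sum_congr rfl fun j _ => ?_
  rw [integral_finsetSum _ fun l _ => (hint j l).const_mul _]
  refine Finset.sum_congr rfl fun l _ => ?_
  rw [integral_const_mul, secondMoment, Matrix.of_apply]
  ring

/-- Tested on a coordinate vector. This keeps the deviation level within the range `t ≤ 2 * G` of
the Bernstein bound. -/
theorem minEig_secondMoment_le (hx : Measurable x) (hκ : psi2NormVec μ x ≤ κ) (hp : 0 < p) :
    minEig (secondMoment μ x) ≤ 2 * (κ : ℝ) ^ 2 := by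
  let e : Vec p := EuclideanSpace.single ⟨0, hp⟩ (1 : ℝ)
  have he : ‖e‖ = 1 := by simp [e]
  have h1 := minEig_mul_le_matrixForm (isSymm_secondMoment (μ := μ) (x := x)) e
  rw [← integral_inner_mul_inner hx hκ, he] at h1
  have h2 := (inner_pow_moment hx hκ he.le le_rfl).2
  simp only [mul_one, pow_one, Nat.cast_one, pow_two] at h1 h2 ⊢
  linarith

end SecondMoment

/-! ### Uniform concentration over sparse directions -/

theorem exists_sparse_net (k p : ℕ) :
    ∃ N : (Fin k → Fin p) → Finset (Vec p),
      (∀ f, IsHalfNet (coordSubspace f) (N f)) ∧ ∀ f, (N f).card ≤ 5 ^ k := by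
  choose N hcard hN using fun f : Fin k → Fin p =>
    exists_isHalfNet (coordSubspace f) (finrank_coordSubspace_le f)
  exact ⟨N, hN, hcard⟩

section Concentration

variable {Ω : Type*} [MeasurableSpace Ω] {μ : Measure Ω} [IsProbabilityMeasure μ] {n p : ℕ}
  {X : Fin n → Ω → Vec p} {κ : ℝ≥0} {Sig : Matrix (Fin p) (Fin p) ℝ}

theorem measureReal_matrixForm_gt_le (hX : ∀ i, Measurable (X i)) (hind : iIndepFun X μ)
    (hκ : ∀ i, psi2NormVec μ (X i) ≤ κ) (hSig : ∀ i, secondMoment μ (X i) = Sig) (hn : 0 < n)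
    {G : ℝ} (hG : G = 4 * Real.exp 1 * ((κ : ℝ) ^ 2 + 1)) {t : ℝ} (ht : 0 ≤ t)
    (htG : t ≤ 2 * G) {a b : Vec p} (ha : ‖a‖ ≤ 1) (hb : ‖b‖ ≤ 1) :
    μ.real {ω | t < |matrixForm (empCov (designMatrix fun i => X i ω) - Sig) a b|} ≤
      2 * Real.exp (-(n * t ^ 2 / (8 * G ^ 2))) := by
  let g : Fin n → Vec p → ℝ := fun i y => inner ℝ y a * inner ℝ y b -
    ∫ ω', inner ℝ (X i ω') a * inner ℝ (X i ω') b ∂μ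
  have hg : ∀ i, Measurable (g i) := fun i =>
    (measurable_id.inner_const.mul measurable_id.inner_const).sub_const _
  have hGpos : 0 < G := by rw [hG]; positivity
  have hmom := fun i m => centered_moment (hX i) (hκ i) ha hb m
  rw [← hG] at hmom
  have h := measureReal_abs_sum_ge_le (V := fun i => g i ∘ X i) (fun i => (hg i).comp (hX i))
    (hind.comp g hg) hGpos (fun i m => (hmom i m).1) (fun i m => (hmom i m).2)
    (fun i => by
      simp only [g, Function.comp_apply]
      rw [integral_sub (integrable_inner_mul_inner (hX i) (hκ i) ha hb) (integrable_const _)]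
      simp) ht htG
  refine (measureReal_mono fun ω hω => ?_).trans h
  have hω' : t < |matrixForm (empCov (designMatrix fun i => X i ω) - Sig) a b| := hω
  have hn' : (0 : ℝ) < n := by exact_mod_cast hn
  have hform : matrixForm (empCov (designMatrix fun i => X i ω) - Sig) a b =
      (1 / (n : ℝ)) * ∑ i, (g i ∘ X i) ω := by
    have h1 : ∀ i, (g i ∘ X i) ω =
        inner ℝ (X i ω) a * inner ℝ (X i ω) b - matrixForm Sig a b := fun i => by
      simp only [g, Function.comp_apply]
      rw [integral_inner_mul_inner (hX i) (hκ i), hSig i]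
    simp_rw [h1]
    rw [Finset.sum_sub_distrib, mul_sub, ← matrixForm_empCov]
    simp only [Finset.sum_const, Finset.card_univ, Fintype.card_fin, nsmul_eq_mul,
      matrixForm_apply, Matrix.sub_mulVec, dotProduct_sub]
    field_simp
  rw [hform, abs_mul, abs_of_pos (by positivity), one_div, inv_mul_eq_div,
    lt_div_iff₀ hn'] at hω'
  show n * t ≤ |∑ i, (g i ∘ X i) ω|
  linarith

/-- Simultaneous concentration of the empirical second moments over a finite set of directions. -/
theorem measureReal_exists_matrixForm_gt_le (hX : ∀ i, Measurable (X i)) (hind : iIndepFun X μ)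
    (hκ : ∀ i, psi2NormVec μ (X i) ≤ κ) (hSig : ∀ i, secondMoment μ (X i) = Sig) (hn : 0 < n)
    {G : ℝ} (hG : G = 4 * Real.exp 1 * ((κ : ℝ) ^ 2 + 1)) {t : ℝ} (ht : 0 ≤ t)
    (htG : t ≤ 2 * G) (N : Finset (Vec p)) (hN : ∀ a ∈ N, ‖a‖ ≤ 1) :
    μ.real {ω | ∃ a ∈ N, ∃ b ∈ N,
        t < |matrixForm (empCov (designMatrix fun i => X i ω) - Sig) a b|} ≤
      (N.card : ℝ) ^ 2 * (2 * Real.exp (-(n * t ^ 2 / (8 * G ^ 2)))) := by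
  let bad : Vec p × Vec p → Set Ω := fun q =>
    {ω | t < |matrixForm (empCov (designMatrix fun i => X i ω) - Sig) q.1 q.2|}
  have hsub : {ω | ∃ a ∈ N, ∃ b ∈ N,
      t < |matrixForm (empCov (designMatrix fun i => X i ω) - Sig) a b|} ⊆
      ⋃ q ∈ N ×ˢ N, bad q := by
    rintro ω ⟨a, ha, b, hb, h⟩
    exact Set.mem_biUnion (x := (a, b)) (Finset.mem_product.2 ⟨ha, hb⟩) h
  refine (measureReal_mono hsub (measure_ne_top _ _)).trans ((measureReal_biUnion_finset_le _ _).trans ?_)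
  refine (Finset.sum_le_card_nsmul _ _ (2 * Real.exp (-(n * t ^ 2 / (8 * G ^ 2)))) ?_).trans ?_
  · intro q hq
    obtain ⟨h1, h2⟩ := Finset.mem_product.1 hq
    exact measureReal_matrixForm_gt_le hX hind hκ hSig hn hG ht htG (hN _ h1) (hN _ h2)
  · rw [Finset.card_product, nsmul_eq_mul, Nat.cast_mul, ← pow_two]

end Concentration

/-- Since `5 ≤ p ^ 3`, the squared net size is at most `p ^ (8 * k)`; the 8 in `c + 8` absorbs it.
-/
theorem net_card_sq_mul_exp_le {c : ℝ} {p k : ℕ} (hp : 2 ≤ p) {E : ℝ}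
    (hE : (c + 8) * k * Real.log p ≤ E) :
    (((p ^ k * 5 ^ k : ℕ) : ℝ)) ^ 2 * (2 * Real.exp (-E)) ≤ 2 * (p : ℝ) ^ (-(c * (k : ℝ))) := by
  have hp' : (2 : ℝ) ≤ p := by exact_mod_cast hp
  have hp0 : (0 : ℝ) < p := by linarith
  have h5 : (5 : ℝ) ≤ (p : ℝ) ^ 3 :=
    le_trans (by norm_num) (pow_le_pow_left₀ (by norm_num) hp' 3)
  have h1 : (((p ^ k * 5 ^ k : ℕ) : ℝ)) ^ 2 ≤ (p : ℝ) ^ (8 * k) := by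
    push_cast
    calc ((p : ℝ) ^ k * 5 ^ k) ^ 2 ≤ ((p : ℝ) ^ k * ((p : ℝ) ^ 3) ^ k) ^ 2 := by gcongr
      _ = (p : ℝ) ^ (8 * k) := by ring
  have h2 : (p : ℝ) ^ (8 * k) = Real.exp (8 * k * Real.log p) := by
    rw [← Real.rpow_natCast, Real.rpow_def_of_pos hp0]
    push_cast
    ring_nf
  have h3 : (p : ℝ) ^ (-(c * (k : ℝ))) = Real.exp (-(c * k * Real.log p)) := by
    rw [Real.rpow_def_of_pos hp0]
    ring_nf
  rw [h3]
  calc _ ≤ Real.exp (8 * k * Real.log p) * (2 * Real.exp (-E)) := by rw [← h2]; gcongr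
    _ = 2 * Real.exp (8 * k * Real.log p - E) := by
      rw [sub_eq_add_neg, Real.exp_add]; ring
    _ ≤ _ := by gcongr; linarith

theorem satisfiesRE_of_matrixForm_le {p k : ℕ} {S : Set (Vec p)}
    (hS : ∀ a : ℝ, ∀ b ∈ S, a • b ∈ S) (hspan : Submodule.span ℝ S = ⊤)
    (hk : ∀ b ∈ S, card b ≤ k) {N : (Fin k → Fin p) → Finset (Vec p)}
    (hN : ∀ f, IsHalfNet (coordSubspace f) (N f)) {A Sig : Matrix (Fin p) (Fin p) ℝ}
    (hSig : Sig.IsSymm) {φ : ℝ} (hφ : 0 < φ)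
    (hM : ∀ f g, ∀ a ∈ N f, ∀ b ∈ N g,
      |matrixForm (A - Sig) a b| ≤ minEig Sig / (128 * φ ^ 2)) :
    SatisfiesRE A (errorCone (snorm S) φ) (minEig Sig / 2) := by
  intro u hu hu0
  have hpos : 0 < ‖u‖ ^ 2 := by positivity
  rw [le_div_iff₀ hpos, ← matrixForm_apply]
  have h1 := abs_bilin_le_of_mem_errorCone hS hspan hk hN (matrixForm (A - Sig)) hM hu0 hu
  have h2 : 64 * φ ^ 2 * (minEig Sig / (128 * φ ^ 2)) * ‖u‖ ^ 2 = minEig Sig / 2 * ‖u‖ ^ 2 := by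
    field_simp
    ring
  have h3 := minEig_mul_le_matrixForm hSig u
  have h4 : matrixForm (A - Sig) u u = matrixForm A u u - matrixForm Sig u u := by
    simp only [matrixForm_apply, Matrix.sub_mulVec, dotProduct_sub]
  rw [h2, h4] at h1
  linarith [(abs_le.1 h1).1]

end StructureNorm

/-! ### Choice of the constant and conclusion -/

theorem mainTheorem6 (c cmin cmax : ℝ) (κ : ℝ≥0) (hc : 0 < c) (hcmin : 0 < cmin) :
    ∃ C : ℝ, 0 < C ∧
      ∀ (n p k : ℕ) (S : Set (StructureNorm.Vec p)),
        IsClosed S →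
        (∀ (a : ℝ), ∀ b ∈ S, a • b ∈ S) →
        Submodule.span ℝ S = ⊤ →
        (∀ b ∈ S, StructureNorm.card b ≤ k) →
      ∀ (βstar : StructureNorm.Vec p), βstar ≠ 0 →
      ∀ (Sig : Matrix (Fin p) (Fin p) ℝ),
        cmin ≤ StructureNorm.minEig Sig →
        StructureNorm.maxEig Sig ≤ cmax →
      ∀ (Ω : Type*) [MeasurableSpace Ω] (μ : Measure Ω) [IsProbabilityMeasure μ]
        (X : Fin n → Ω → StructureNorm.Vec p),
        (∀ i, Measurable (X i)) →
        iIndepFun X μ →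
        (∀ i, StructureNorm.psi2NormVec μ (X i) ≤ (κ : ℝ≥0∞)) →
        (∀ i, StructureNorm.secondMoment μ (X i) = Sig) →
        C * (StructureNorm.minEig Sig)⁻¹ ^ 2
            * StructureNorm.relDiam (StructureNorm.snorm S) βstar ^ 4 * (k : ℝ) * Real.log (p : ℝ)
          ≤ (n : ℝ) →
        1 - 2 * (p : ℝ) ^ (-(c * (k : ℝ))) ≤
          μ.real {ω | StructureNorm.SatisfiesRE
            (StructureNorm.empCov (StructureNorm.designMatrix fun i => X i ω))
            (StructureNorm.errorCone (StructureNorm.snorm S)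
              (StructureNorm.relDiam (StructureNorm.snorm S) βstar))
            (StructureNorm.minEig Sig / 2)} := by
  have hGpos : 0 < 4 * Real.exp 1 * ((κ : ℝ) ^ 2 + 1) := by positivity
  obtain ⟨G, hG⟩ : ∃ G : ℝ, G = 4 * Real.exp 1 * ((κ : ℝ) ^ 2 + 1) := ⟨_, rfl⟩
  rw [← hG] at hGpos
  -- `131072 = 8 * 128 ^ 2`, from the exponent `n t² / (8 G²)` at `t = l / (128 φ²)`.
  refine ⟨131072 * G ^ 2 * (c + 8), by positivity, ?_⟩
  intro n p k S _ hS hspan hk βstar hβ Sig hmin _ Ω _ μ _ X hX hind hκ hSig hn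
  obtain ⟨φ, hφdef⟩ : ∃ φ, φ = StructureNorm.relDiam (StructureNorm.snorm S) βstar := ⟨_, rfl⟩
  rw [← hφdef] at hn ⊢
  have hp0 : 0 < p := by
    rcases Nat.eq_zero_or_pos p with rfl | h
    · exact absurd (Subsingleton.elim βstar 0) hβ
    · exact h
  -- Here `p ^ (-(c k)) = 1`, so the claimed lower bound is negative.
  by_cases htriv : p = 1 ∨ k = 0
  · have h1 : (p : ℝ) ^ (-(c * (k : ℝ))) = 1 := by
      rcases htriv with rfl | rfl <;> simp
    rw [h1]
    exact le_trans (by norm_num) measureReal_nonneg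
  obtain ⟨hp1, hk0⟩ := not_or.1 htriv
  have hp2 : 2 ≤ p := by omega
  have hppos : (0 : ℝ) ≤ (p : ℝ) ^ (-(c * (k : ℝ))) := by positivity
  -- Otherwise the cone has no nonzero element and the condition is vacuous.
  by_cases hφ : 1 ≤ 2 * φ
  swap
  · have huniv : {ω | StructureNorm.SatisfiesRE
        (StructureNorm.empCov (StructureNorm.designMatrix fun i => X i ω))
        (StructureNorm.errorCone (StructureNorm.snorm S) φ)
        (StructureNorm.minEig Sig / 2)} = Set.univ :=
      Set.eq_univ_of_forall fun ω u hu hu0 =>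
        absurd (StructureNorm.one_le_of_mem_errorCone hS hspan hu0 hu) hφ
    rw [huniv, probReal_univ]
    linarith
  have hφ0 : 0 < φ := by linarith
  set l := StructureNorm.minEig Sig with hl
  have hl0 : 0 < l := hcmin.trans_le hmin
  have hlog : 0 < Real.log p := Real.log_pos (by exact_mod_cast hp2)
  have hkpos : (0 : ℝ) < k := by exact_mod_cast Nat.pos_of_ne_zero hk0
  have hn0 : 0 < n := by
    have : (0 : ℝ) < n := lt_of_lt_of_le (by positivity) hn
    exact_mod_cast this
  have hSymm : Sig.IsSymm := hSig ⟨0, hn0⟩ ▸ StructureNorm.isSymm_secondMoment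
  have hlκ : l ≤ 2 * (κ : ℝ) ^ 2 := by
    rw [hl, ← hSig ⟨0, hn0⟩]
    exact StructureNorm.minEig_secondMoment_le (hX _) (hκ _) hp0
  set t : ℝ := l / (128 * φ ^ 2) with ht
  have ht0 : 0 ≤ t := by positivity
  have htG : t ≤ 2 * G := by
    have h1 : t ≤ l := div_le_self hl0.le (by nlinarith)
    have h2 : (1 : ℝ) ≤ Real.exp 1 := Real.one_le_exp zero_le_one
    rw [hG]
    nlinarith [sq_nonneg (κ : ℝ)]
  have hE : (c + 8) * k * Real.log p ≤ n * t ^ 2 / (8 * G ^ 2) := by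
    have h1 : n * t ^ 2 / (8 * G ^ 2) = n * (l ^ 2 / (131072 * G ^ 2 * φ ^ 4)) := by
      rw [ht]
      field_simp
      norm_num
    rw [h1]
    calc (c + 8) * k * Real.log p
        = 131072 * G ^ 2 * (c + 8) * l⁻¹ ^ 2 * φ ^ 4 * k * Real.log p
            * (l ^ 2 / (131072 * G ^ 2 * φ ^ 4)) := by field_simp
      _ ≤ _ := by gcongr
  classical
  obtain ⟨N, hN, hcard⟩ := StructureNorm.exists_sparse_net k p
  let T : Finset (StructureNorm.Vec p) := Finset.univ.biUnion N
  have hTcard : T.card ≤ p ^ k * 5 ^ k := by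
    refine (Finset.card_biUnion_le_card_mul _ _ _ fun f _ => hcard f).trans ?_
    simp
  have hT : ∀ a ∈ T, ‖a‖ ≤ 1 := by
    intro a ha
    obtain ⟨f, -, hf⟩ := Finset.mem_biUnion.1 ha
    exact (hN f).norm_le a hf
  have hbad := StructureNorm.measureReal_exists_matrixForm_gt_le hX hind hκ hSig hn0 hG ht0 htG T hT
  have hbad' := hbad.trans ((mul_le_mul_of_nonneg_right (pow_le_pow_left₀ (Nat.cast_nonneg _)
    (Nat.cast_le.2 hTcard) 2) (by positivity)).trans
      (StructureNorm.net_card_sq_mul_exp_le hp2 hE))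
  set bad : Set Ω := {ω | ∃ a ∈ T, ∃ b ∈ T, t < |StructureNorm.matrixForm
    (StructureNorm.empCov (StructureNorm.designMatrix fun i => X i ω) - Sig) a b|}
  -- Subadditivity over a cover bounds the good event from below without its measurability.
  have hcover : (Set.univ : Set Ω) ⊆ {ω | StructureNorm.SatisfiesRE
      (StructureNorm.empCov (StructureNorm.designMatrix fun i => X i ω))
      (StructureNorm.errorCone (StructureNorm.snorm S) φ) (l / 2)} ∪ bad := by
    intro ω _
    by_cases hω : ω ∈ bad
    · exact Or.inr hω
    · refine Or.inl (StructureNorm.satisfiesRE_of_matrixForm_le hS hspan hk hN hSymm hφ0 ?_)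
      intro f g a ha b hb
      by_contra! hlt
      exact hω ⟨a, Finset.mem_biUnion.2 ⟨f, Finset.mem_univ _, ha⟩, b,
        Finset.mem_biUnion.2 ⟨g, Finset.mem_univ _, hb⟩, hlt⟩
  have hone := (measureReal_mono (μ := μ) hcover).trans (measureReal_union_le _ _)
  rw [probReal_univ] at hone
  linarith
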